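/- Let $\alpha\ge -1$ be a real number. For integers $n,k\ge 0$ put $$B_{n,k}=\binom{n+\alpha}{n-k}\frac{n!}{k!}\quad(0\le k\le n),\qquad B_{n,k}=0\quad(k>n),$$ where $\binom{x}{m}=x(x-1)\cdots(x-m+1)/m!$ for real $x$. Let $L^{(\alpha)}_n(q)=\sum_{k=0}^n B_{n,k}(-q)^k$ be the Laguerre polynomials, $\widetilde L^{(\alpha)}_n(q)=L^{(\alpha)}_n(-q)=\sum_{k=0}^n B_{n,k}q^k$ the signless Laguerre polynomials, and $\widetilde L^{(\alpha)*}_n(q)=q^n\widetilde L^{(\alpha)}_n(1/q)$ their reciprocal polynomials. A sequence $(a_n(q))_{n\ge0}$ in $\mathbb{R}[q]$ is called $q$-Stieltjes moment if every minor of its infinite Hankel matrix $[a_{i+j}(q)]_{i,j\ge0}$ is a polynomial in $q$ with nonnegative coefficients. Let $\mathcal L$ be the operator that sends a sequence $(a_i)$ to the sequence $\mathcal L[a_i]=a_{i-1}a_{i+1}-a_i^2$, defined for those $i$ for which $a_{i-1}$ is defined (so $\mathcal L^m[a_i]$ is defined for $i\ge m$). The sequence is called $3$-$q$-log-convex if $\mathcal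 L^m[a_i]$ has nonnegative coefficients for all $0\le m\le 3$ and all $i\ge m$. A real sequence $(x_n)_{n\ge0}$ is a Stieltjes moment sequence if there is a nonnegative measure $\mu$ on $[0,\infty)$ with $x_n=\int_0^\infty t^n\,d\mu(t)$ (the integral being finite) for all $n\ge0$. Then: (i) both $(\widetilde L^{(\alpha)}_n(q))_{n\ge0}$ and $(\widetilde L^{(\alpha)*}_n(q))_{n\ge0}$ are $q$-Stieltjes moment and $3$-$q$-log-convex; (ii) the infinite triangular matrix $[B_{n,k}]_{n,k\ge0}$ is totally positive, that is, all its minors are nonnegative; (iii) if $(x_n)_{n\ge0}$ and $(y_n)_{n\ge0}$ are Stieltjes moment sequences of real numbers, then so is the sequence $z_n=\sum_{k=0}^n\binom{n+\alpha}{n-k}\frac{n!}{k!}\,x_k\,y_{n-k}$, $n\ge0$. -/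

import Mathlib

open Polynomial MeasureTheory
open scoped Nat

noncomputable section

/-- An infinite real matrix is totally positive if all its minors are nonnegative; a minor is given
by increasing choices of `m` rows and of `m` columns. -/
def IsTotallyPositive (M : ℕ → ℕ → ℝ) : Prop :=
  ∀ (m : ℕ) (r c : Fin m → ℕ), StrictMono r → StrictMono c →
    0 ≤ (Matrix.of fun i j : Fin m => M (r i) (c j)).det

/-- Membership in `ℝ≥0[q]`: all coefficients are nonnegative. -/
def HasNonnegCoeffs (p : ℝ[X]) : Prop := ∀ i : ℕ, 0 ≤ p.coeff i

/-- An infinite matrix of polynomials in `q` is `q`-totally positive if all its minors are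
polynomials with nonnegative coefficients. -/
def IsQTotallyPositive (M : ℕ → ℕ → ℝ[X]) : Prop :=
  ∀ (m : ℕ) (r c : Fin m → ℕ), StrictMono r → StrictMono c →
    HasNonnegCoeffs (Matrix.of fun i j : Fin m => M (r i) (c j)).det

/-- A sequence of polynomials in `q` is a `q`-Stieltjes moment sequence if its Hankel matrix is
`q`-totally positive. -/
def IsQStieltjesMoment (a : ℕ → ℝ[X]) : Prop :=
  IsQTotallyPositive fun i j => a (i + j)

/-- The operator `𝓛[a_i] = a_{i-1} a_{i+1} - a_i ^ 2`, defined for `i ≥ 1`. Its output, a sequence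
indexed by `i ≥ 1`, is re-indexed from `0`: the entry with index `n` is `𝓛[a_{n+1}]`. -/
def logConvexOp (a : ℕ → ℝ[X]) : ℕ → ℝ[X] :=
  fun n => a n * a (n + 2) - a (n + 1) ^ 2

/-- `k`-`q`-log-convexity: `𝓛 ^ m` of the sequence has all its entries in `ℝ≥0[q]`, for every
`m ≤ k`. -/
def IsIteratedQLogConvex (k : ℕ) (a : ℕ → ℝ[X]) : Prop :=
  ∀ m ≤ k, ∀ n : ℕ, HasNonnegCoeffs (logConvexOp^[m] a n)

/-- A real sequence is a Stieltjes moment sequence if it is the sequence of moments of a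
nonnegative measure carried by `[0, ∞)` (all of whose moments exist). -/
def IsStieltjesMoment (a : ℕ → ℝ) : Prop :=
  ∃ μ : Measure ℝ, μ (Set.Iio 0) = 0 ∧
    ∀ k : ℕ, Integrable (fun x : ℝ => x ^ k) μ ∧ a k = ∫ x, x ^ k ∂μ

/-- The `A`-convolution `z_n = ∑_{k=0}^n A_{n,k} x_k y_{n-k}`. -/
def triangularConvolution (A : ℕ → ℕ → ℝ) (x y : ℕ → ℝ) : ℕ → ℝ :=
  fun n => ∑ k ∈ Finset.range (n + 1), A n k * x k * y (n - k)

/-- The `A`-convolution preserves the Stieltjes moment property. -/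
def PreservesStieltjesMoment (A : ℕ → ℕ → ℝ) : Prop :=
  ∀ x y : ℕ → ℝ, IsStieltjesMoment x → IsStieltjesMoment y →
    IsStieltjesMoment (triangularConvolution A x y)

/-- The lower triangular matrix `[binom(n + α, n - k) n! / k!]_{n,k}`, with the generalized
binomial coefficient of a real upper argument. -/
def laguerreTriangle (α : ℝ) (n k : ℕ) : ℝ :=
  if k ≤ n then Ring.choose ((n : ℝ) + α) (n - k) * ((n ! : ℝ) / (k ! : ℝ)) else 0

/-- The Laguerre polynomial `L_n^{(α)}(q) = ∑_{k=0}^n binom(n + α, n - k) (n! / k!) (-q)^k`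
(normalized with the factor `n!`). -/
def laguerrePoly (α : ℝ) (n : ℕ) : ℝ[X] :=
  ∑ k ∈ Finset.range (n + 1), C (laguerreTriangle α n k) * (-X) ^ k

/-- The signless Laguerre polynomial `L_n^{(α)}(-q)`. -/
def signlessLaguerrePoly (α : ℝ) (n : ℕ) : ℝ[X] :=
  (laguerrePoly α n).comp (-X)

/-- The reciprocal polynomial `q^n p(1/q)` of the `n`-th signless Laguerre polynomial `p`. -/
def signlessLaguerreReciprocal (α : ℝ) (n : ℕ) : ℝ[X] :=
  (signlessLaguerrePoly α n).reflect n

/-- The generalized binomial coefficient used above is `x (x - 1) ⋯ (x - m + 1) / m!`. -/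
theorem ring_choose_real_eq (x : ℝ) (m : ℕ) :
    Ring.choose x m = (∏ i ∈ Finset.range m, (x - (i : ℝ))) / (m ! : ℝ) := by
  rw [Ring.choose_eq_smul, ← descPochhammer_eval_eq_prod_range, smul_eq_mul, div_eq_inv_mul,
    ← descPochhammer_map (Int.castRingHom ℝ) m, Polynomial.eval_map,
    ← Polynomial.aeval_eq_smeval]
  rfl

theorem signlessLaguerrePoly_eq_sum (α : ℝ) (n : ℕ) :
    signlessLaguerrePoly α n =
      ∑ k ∈ Finset.range (n + 1), C (laguerreTriangle α n k) * X ^ k := by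
  simp [signlessLaguerrePoly, laguerrePoly, Polynomial.sum_comp]

/-- The reciprocal polynomial takes the value `q^n p(1/q)` at every `q ≠ 0`. -/
theorem eval_signlessLaguerreReciprocal (α : ℝ) (n : ℕ) {q : ℝ} (hq : q ≠ 0) :
    (signlessLaguerreReciprocal α n).eval q =
      q ^ n * (signlessLaguerrePoly α n).eval (1 / q) := by
  have hd : (signlessLaguerrePoly α n).natDegree ≤ n := by
    rw [signlessLaguerrePoly_eq_sum]
    refine Polynomial.natDegree_sum_le_of_forall_le _ _ fun k hk => ?_
    exact (Polynomial.natDegree_C_mul_X_pow_le _ _).trans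
      (Nat.lt_succ_iff.mp (Finset.mem_range.mp hk))
  let _ : Invertible (q⁻¹) := invertibleOfNonzero (inv_ne_zero hq)
  have h := Polynomial.eval₂_reflect_mul_pow (RingHom.id ℝ) (q⁻¹) n _ hd
  simp only [invOf_eq_inv, inv_inv] at h
  rw [signlessLaguerreReciprocal, one_div]
  simp only [Polynomial.eval]
  rw [← h, mul_comm (q ^ n), mul_assoc, inv_pow, inv_mul_cancel₀ (pow_ne_zero n hq), mul_one]

end

/-! (i) and (ii) come from one production matrix. The polynomials `p_n(z) = ∑ B_{n,k} y^{n-k} z^k`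
satisfy `p_{n+1} = (z (1 + y∂) + (α+1) y) (1 + y∂) p_n`, and replacing `z` by `z + x` only changes
the factor `z` into `z + x`. In the basis of monomials this operator is a product of staircase
matrices with entries in the semiring generated by `x`, `y`, `α + 1`, so Cauchy–Binet puts all its
minors in that semiring (`minorsMem_laguerreProduction`). Minors then pass to the matrix of
coefficients of `p_n(z + x)` and to the Hankel matrix of its zeroth column `p_n(x)`, because
`(P^{i+j})_{00} = ∑_k (P^i)_{0k} (P^j)_{k0}`. Choosing `x`, `y` among `0`, `1`, `q` gives the
statements wanted.

3-`q`-log-convexity follows from Hankel minors of order at most 4: iterates of `𝓛` factor through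
them by the Desnanot–Jacobi identity.

(iii) is probabilistic. For `s ≥ 0`, `t > 0`, the number `∑ B_{n,k} s^k t^{n-k}` is the `n`-th
moment of `t G`, where `N` is Poisson of mean `s/t` and `G`, given `N`, is gamma of shape `α + 1 +
N`; for `t = 0` it is the moment `s^n` of a point mass. Mixing these laws over `μ × ν` represents
`z_n`. -/

/-- All minors of the infinite matrix `M` lie in the subsemiring `S`. -/
def MinorsMem {R : Type*} [CommRing R] (S : Subsemiring R) (M : ℕ → ℕ → R) : Prop :=
  ∀ (m : ℕ) (r c : Fin m → ℕ), StrictMono r → StrictMono c →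
    (Matrix.of fun i j : Fin m => M (r i) (c j)).det ∈ S

/-! ### Cauchy–Binet, staircase matrices and production matrices -/

section Minors

variable {R : Type*} [CommRing R] {S : Subsemiring R}

theorem det_sum_mul {m : ℕ} (K : Finset ℕ) (A : Fin m → ℕ → R) (B : ℕ → Fin m → R) :
    (Matrix.of fun i j : Fin m => ∑ k ∈ K, A i k * B k j).det =
      ∑ f ∈ Fintype.piFinset fun _ : Fin m => K,
        (∏ i, A i (f i)) * (Matrix.of fun i j : Fin m => B (f i) j).det := by
  have h1 : (Matrix.of fun i j : Fin m => ∑ k ∈ K, A i k * B k j) =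
      fun i => ∑ k ∈ K, A i k • B k := by
    ext i j
    simp [Finset.sum_apply]
  have h2 := (Matrix.detRowAlternating (R := R) (n := Fin m)).toMultilinearMap.map_sum_finset
    (fun i k => A i k • B k) (fun _ => K)
  have h3 : (Matrix.of fun i j : Fin m => ∑ k ∈ K, A i k * B k j).det =
      (Matrix.detRowAlternating (R := R) (n := Fin m)).toMultilinearMap
        (fun i => ∑ k ∈ K, A i k • B k) := by rw [h1]; rfl
  rw [h3, h2]
  refine Finset.sum_congr rfl fun f _ => ?_
  rw [MultilinearMap.map_smul_univ]
  rfl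

/-- The Cauchy–Binet formula. -/
theorem det_sum_mul_eq_sum_powersetCard {m : ℕ} (K : Finset ℕ) (A : Fin m → ℕ → R)
    (B : ℕ → Fin m → R) :
    (Matrix.of fun i j : Fin m => ∑ k ∈ K, A i k * B k j).det =
      ∑ s ∈ (K.powersetCard m).attach,
        (Matrix.of fun i j : Fin m =>
          A i (s.1.orderEmbOfFin (Finset.mem_powersetCard.mp s.2).2 j)).det *
        (Matrix.of fun i j : Fin m =>
          B (s.1.orderEmbOfFin (Finset.mem_powersetCard.mp s.2).2 i) j).det := by
  classical
  rw [det_sum_mul]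
  -- A choice of rows with a repetition contributes a determinant with two equal rows.
  have hinj : ∑ f ∈ Fintype.piFinset fun _ : Fin m => K,
        (∏ i, A i (f i)) * (Matrix.of fun i j : Fin m => B (f i) j).det =
      ∑ f ∈ (Fintype.piFinset fun _ : Fin m => K) with Function.Injective f,
        (∏ i, A i (f i)) * (Matrix.of fun i j : Fin m => B (f i) j).det := by
    symm
    refine Finset.sum_subset (Finset.filter_subset _ _) fun f hf hf' => ?_
    have hni : ¬ Function.Injective f := fun h => hf' (Finset.mem_filter.mpr ⟨hf, h⟩)
    simp only [Function.Injective, not_forall] at hni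
    obtain ⟨a, b, hab, hne⟩ := hni
    rw [Matrix.det_zero_of_row_eq hne, mul_zero]
    ext j
    simp [hab]
  rw [hinj]
  have hexp : ∀ s : {x // x ∈ K.powersetCard m},
      (Matrix.of fun i j : Fin m =>
          A i (s.1.orderEmbOfFin (Finset.mem_powersetCard.mp s.2).2 j)).det *
        (Matrix.of fun i j : Fin m =>
          B (s.1.orderEmbOfFin (Finset.mem_powersetCard.mp s.2).2 i) j).det =
      ∑ σ : Equiv.Perm (Fin m),
        (∏ i, A i (s.1.orderEmbOfFin (Finset.mem_powersetCard.mp s.2).2 (σ i))) *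
        (Matrix.of fun i j : Fin m =>
          B (s.1.orderEmbOfFin (Finset.mem_powersetCard.mp s.2).2 (σ i)) j).det := by
    intro s
    rw [← Matrix.det_transpose, Matrix.det_apply', Finset.sum_mul]
    refine Finset.sum_congr rfl fun σ _ => ?_
    have := Matrix.det_permute σ (Matrix.of fun i j : Fin m =>
          B (s.1.orderEmbOfFin (Finset.mem_powersetCard.mp s.2).2 i) j)
    have h2 : (Matrix.of fun i j : Fin m =>
          B (s.1.orderEmbOfFin (Finset.mem_powersetCard.mp s.2).2 (σ i)) j) =
        (Matrix.of fun i j : Fin m =>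
          B (s.1.orderEmbOfFin (Finset.mem_powersetCard.mp s.2).2 i) j).submatrix σ id := rfl
    rw [h2, this]
    simp only [Matrix.transpose_apply, Matrix.of_apply]
    ring
  rw [Finset.sum_congr rfl fun s _ => hexp s, Finset.sum_sigma']
  symm
  -- An injective choice of rows is a pair: its image, listed increasingly, and a permutation.
  refine Finset.sum_bij (fun p _ => fun i =>
    p.1.1.orderEmbOfFin (Finset.mem_powersetCard.mp p.1.2).2 (p.2 i)) ?_ ?_ ?_ ?_
  · rintro ⟨⟨s, hs⟩, σ⟩ -
    have hs' := Finset.mem_powersetCard.mp hs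
    refine Finset.mem_filter.mpr ⟨Fintype.mem_piFinset.mpr fun i =>
      hs'.1 (Finset.orderEmbOfFin_mem s hs'.2 _), ?_⟩
    exact (s.orderEmbOfFin hs'.2).injective.comp σ.injective
  · rintro ⟨⟨s, hs⟩, σ⟩ - ⟨⟨t, ht⟩, τ⟩ - h
    have hs' := Finset.mem_powersetCard.mp hs
    have ht' := Finset.mem_powersetCard.mp ht
    have hst : s = t := by
      have h1 := congrArg Set.range h
      have h2 : ∀ (u : Finset ℕ) (hu : u.card = m) (ρ : Equiv.Perm (Fin m)),
          Set.range (fun i => u.orderEmbOfFin hu (ρ i)) = (u : Set ℕ) := by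
        intro u hu ρ
        rw [← Finset.range_orderEmbOfFin u hu]
        exact ρ.surjective.range_comp (u.orderEmbOfFin hu)
      exact Finset.coe_injective ((h2 s hs'.2 σ).symm.trans (h1.trans (h2 t ht'.2 τ)))
    subst hst
    have : σ = τ := by
      ext i
      have := congrFun h i
      exact congrArg Fin.val ((s.orderEmbOfFin hs'.2).injective this)
    rw [this]
  · intro f hf
    obtain ⟨hf, hfi⟩ := Finset.mem_filter.mp hf
    have hcard : (Finset.univ.image f).card = m := by
      rw [Finset.card_image_of_injective _ hfi, Finset.card_univ, Fintype.card_fin]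
    have hmem : Finset.univ.image f ∈ K.powersetCard m := by
      refine Finset.mem_powersetCard.mpr ⟨fun x hx => ?_, hcard⟩
      obtain ⟨i, -, rfl⟩ := Finset.mem_image.mp hx
      exact Fintype.mem_piFinset.mp hf i
    let g : Fin m → Fin m := fun i => ((Finset.univ.image f).orderIsoOfFin hcard).symm
      ⟨f i, Finset.mem_image_of_mem f (Finset.mem_univ i)⟩
    have hg : ∀ i, (Finset.univ.image f).orderEmbOfFin hcard (g i) = f i := fun i => by
      rw [← Finset.coe_orderIsoOfFin_apply]
      simp [g]
    have hgi : Function.Injective g := fun a b hab => hfi (by rw [← hg a, ← hg b, hab])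
    exact ⟨⟨⟨_, hmem⟩, Equiv.ofBijective g (Finite.injective_iff_bijective.mp hgi)⟩,
      Finset.mem_sigma.mpr ⟨Finset.mem_attach _ _, Finset.mem_univ _⟩, funext hg⟩
  · rintro ⟨⟨s, hs⟩, σ⟩ -
    rfl

theorem det_mem_of_sum_mul {m : ℕ} {K : Finset ℕ} {A : Fin m → ℕ → R} {B : ℕ → Fin m → R}
    (hA : ∀ k : Fin m → ℕ, StrictMono k → (Matrix.of fun i j : Fin m => A i (k j)).det ∈ S)
    (hB : ∀ k : Fin m → ℕ, StrictMono k → (Matrix.of fun i j : Fin m => B (k i) j).det ∈ S) :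
    (Matrix.of fun i j : Fin m => ∑ k ∈ K, A i k * B k j).det ∈ S := by
  rw [det_sum_mul_eq_sum_powersetCard]
  exact sum_mem fun s _ => mul_mem (hA _ (OrderEmbedding.strictMono _))
    (hB _ (OrderEmbedding.strictMono _))

theorem MinorsMem.transpose {M : ℕ → ℕ → R} (h : MinorsMem S M) :
    MinorsMem S fun i j => M j i := fun m r c hr hc => by
  rw [← Matrix.det_transpose]
  exact h m c r hc hr

/-- An infinite matrix product with finite sums is encoded by its long partial sums; a minor sees
finitely many entries, so one truncation serves them all. -/
theorem det_mem_of_eventually_eq_sum {m : ℕ} {M : Fin m → Fin m → R} {A : Fin m → ℕ → R}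
    {B : ℕ → Fin m → R}
    (hA : ∀ k : Fin m → ℕ, StrictMono k → (Matrix.of fun i j : Fin m => A i (k j)).det ∈ S)
    (hB : ∀ k : Fin m → ℕ, StrictMono k → (Matrix.of fun i j : Fin m => B (k i) j).det ∈ S)
    (hM : ∀ i j, ∀ᶠ N in Filter.atTop, M i j = ∑ k ∈ Finset.range N, A i k * B k j) :
    (Matrix.of fun i j : Fin m => M i j).det ∈ S := by
  obtain ⟨N, hN⟩ := (Filter.eventually_all.mpr fun i =>
    Filter.eventually_all.mpr fun j => hM i j).exists
  have : (Matrix.of fun i j : Fin m => M i j) =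
      Matrix.of fun i j : Fin m => ∑ k ∈ Finset.range N, A i k * B k j := by
    ext i j
    exact hN i j
  rw [this]
  exact det_mem_of_sum_mul hA hB

theorem MinorsMem.mul {M A B : ℕ → ℕ → R} (hA : MinorsMem S A) (hB : MinorsMem S B)
    (hM : ∀ i j, ∀ᶠ N in Filter.atTop, M i j = ∑ k ∈ Finset.range N, A i k * B k j) :
    MinorsMem S M := fun m r c hr hc =>
  det_mem_of_eventually_eq_sum (M := fun i j => M (r i) (c j)) (A := fun i k => A (r i) k)
    (B := fun k j => B k (c j)) (fun k hk => hA m r k hr hk) (fun k hk => hB m k c hk hc)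
    fun i j => hM (r i) (c j)

/-- In a matrix whose nonzero entries move weakly to the right from row to row, every minor is the
product of its diagonal entries. -/
theorem MinorsMem.of_staircase {M : ℕ → ℕ → R} (hmem : ∀ i j, M i j ∈ S)
    (hM : ∀ i i' j j', i < i' → M i j ≠ 0 → M i' j' ≠ 0 → j ≤ j') : MinorsMem S M := by
  intro m r c hr hc
  rw [← Matrix.det_transpose, Matrix.det_apply', Finset.sum_eq_single (1 : Equiv.Perm (Fin m))]
  · simpa using prod_mem fun i _ => hmem (r i) (c i)
  · intro σ _ hσ
    by_cases h : ∀ i, M (r i) (c (σ i)) ≠ 0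
    -- A permutation that meets only nonzero entries is increasing, hence the identity.
    · refine absurd ?_ hσ
      have hmono : Monotone σ := by
        refine fun i i' hii => ?_
        rcases hii.eq_or_lt with rfl | hlt
        · exact le_rfl
        · exact hc.le_iff_le.mp (hM _ _ _ _ (hr hlt) (h i) (h i'))
      have hs : StrictMono σ := hmono.strictMono_of_injective σ.injective
      ext i
      have : (hs.orderIsoOfSurjective σ σ.surjective) = OrderIso.refl _ := Subsingleton.elim _ _
      have := congrArg (fun e : Fin m ≃o Fin m => (e i : ℕ)) this
      simpa using this
    · push Not at h
      obtain ⟨i, hi⟩ := h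
      rw [Finset.prod_eq_zero (Finset.mem_univ i), mul_zero]
      simpa using hi
  · simp

/-- The output matrix of a production matrix whose minors lie in `S`. -/
theorem MinorsMem.of_production {M P : ℕ → ℕ → R} (hP : MinorsMem S P)
    (h0 : ∀ k, M 0 k = if k = 0 then 1 else 0)
    (hM : ∀ i j, ∀ᶠ N in Filter.atTop, M (i + 1) j = ∑ k ∈ Finset.range N, M i k * P k j) :
    MinorsMem S M := by
  suffices h : ∀ (n m : ℕ) (r c : Fin m → ℕ), StrictMono r → StrictMono c → (∀ i, r i < n) →
      (Matrix.of fun i j : Fin m => M (r i) (c j)).det ∈ S by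
    intro m r c hr hc
    exact h (∑ i, r i + 1) m r c hr hc fun i =>
      Nat.lt_succ_of_le (Finset.single_le_sum (fun _ _ => Nat.zero_le _) (Finset.mem_univ i))
  intro n
  induction n with
  | zero =>
    intro m r c _ _ h
    cases m with
    | zero => simp
    | succ m => exact absurd (h 0) (Nat.not_lt_zero _)
  | succ n ih =>
    -- Without row `0`, the chosen rows are earlier rows multiplied by `P`, and Cauchy–Binet lowers
    -- the bound on the rows.
    have key : ∀ (m : ℕ) (r c : Fin m → ℕ), StrictMono r → StrictMono c → (∀ i, r i < n + 1) →
        (∀ i, 0 < r i) → (Matrix.of fun i j : Fin m => M (r i) (c j)).det ∈ S := by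
      intro m r c hr hc hn hpos
      refine det_mem_of_eventually_eq_sum (M := fun i j => M (r i) (c j))
        (A := fun i k => M (r i - 1) k) (B := fun k j => P k (c j)) (fun k hk => ?_)
        (fun k hk => hP m k c hk hc) fun i j => ?_
      · refine ih m (fun i => r i - 1) k (fun i j hij => ?_) hk fun i => ?_
        · have := hr hij
          have := hpos i
          change r i - 1 < r j - 1
          omega
        · have := hn i
          have := hpos i
          change r i - 1 < n
          omega
      · have := hM (r i - 1) (c j)
        rwa [Nat.sub_add_cancel (hpos i)] at this
    intro m r c hr hc hn
    cases m with
    | zero => simp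
    | succ m =>
      by_cases hr0 : r 0 = 0
      · by_cases hc0 : c 0 = 0
        -- Row `0` is the first unit vector: Laplace expansion along it leaves a minor covered by
        -- `key`.
        · rw [Matrix.det_succ_row_zero, Finset.sum_eq_single 0]
          · have hrs : StrictMono fun i : Fin m => r i.succ := hr.comp (Fin.strictMono_succ)
            have hcs : StrictMono fun i : Fin m => c i.succ := hc.comp (Fin.strictMono_succ)
            have := key m (fun i => r i.succ) (fun i => c i.succ) hrs hcs (fun i => hn _)
              fun i => lt_of_le_of_lt (Nat.zero_le _) (hr (Fin.succ_pos i))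
            simpa [hr0, hc0, h0, Matrix.submatrix] using this
          · intro j _ hj
            have : c j ≠ 0 := by
              have := hc (Fin.pos_of_ne_zero hj)
              omega
            simp [hr0, h0, this]
          · simp
        · rw [Matrix.det_eq_zero_of_row_eq_zero 0]
          · exact zero_mem S
          · intro j
            have : c j ≠ 0 := by
              have := hc.monotone (Fin.zero_le j)
              omega
            simp [hr0, h0, this]
      · exact key _ r c hr hc hn fun i => by
          have := hr.monotone (Fin.zero_le i)
          omega

/-- The zeroth column of the output matrix of a production matrix whose minors lie in `S` has a
Hankel matrix whose minors lie in `S`. -/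
theorem MinorsMem.hankel_of_production {M P : ℕ → ℕ → R} (hP : MinorsMem S P)
    (hP0 : ∀ k l, k + 1 < l → P k l = 0) (h0 : ∀ k, M 0 k = if k = 0 then 1 else 0)
    (hM0 : ∀ i k, i < k → M i k = 0)
    (hM : ∀ i j, M (i + 1) j = ∑ k ∈ Finset.range (i + 1), M i k * P k j) :
    MinorsMem S fun i j => M (i + j) 0 := by
  have hME : ∀ i j, ∀ᶠ N in Filter.atTop, M (i + 1) j = ∑ k ∈ Finset.range N, M i k * P k j := by
    intro i j
    filter_upwards [Filter.eventually_ge_atTop (i + 1)] with N hN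
    rw [hM]
    refine Finset.sum_subset (Finset.range_mono hN) fun k _ hk => ?_
    rw [hM0 i k (by simpa using hk), zero_mul]
  -- `C j k` stands for `(P^j)_{k0}`: it is the output matrix of the transpose of `P`. Since `P k l
  -- = 0` for `l > k + 1`, sums up to `k + 1` suffice.
  let C : ℕ → ℕ → R := fun j => Nat.rec (fun k => if k = 0 then 1 else 0)
    (fun _ v k => ∑ l ∈ Finset.range (k + 2), v l * P k l) j
  have hC0 : ∀ k, C 0 k = if k = 0 then 1 else 0 := fun _ => rfl
  have hCs : ∀ j k, C (j + 1) k = ∑ l ∈ Finset.range (k + 2), C j l * P k l := fun _ _ => rfl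
  have hC : MinorsMem S C := by
    refine MinorsMem.of_production hP.transpose hC0 fun j k => ?_
    filter_upwards [Filter.eventually_ge_atTop (k + 2)] with N hN
    rw [hCs]
    refine Finset.sum_subset (Finset.range_mono hN) fun l _ hl => ?_
    rw [hP0 k l (not_lt.mp fun h => hl (Finset.mem_range.mpr h)), mul_zero]
  -- The induction carries one factor `P` at a time from the left power to the right one.
  have hsum : ∀ j i, M (i + j) 0 = ∑ k ∈ Finset.range (i + 1), M i k * C j k := by
    intro j
    induction j with
    | zero => intro i; simp [hC0]
    | succ j ih =>
      intro i
      rw [← Nat.succ_add_eq_add_succ, ih]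
      simp only [hM i, hCs, Finset.sum_mul, Finset.mul_sum]
      rw [Finset.sum_comm]
      refine Finset.sum_congr rfl fun k hk => ?_
      have hk' : k + 2 ≤ i.succ + 1 := by
        have := Finset.mem_range.mp hk
        omega
      symm
      refine (Finset.sum_subset (Finset.range_mono hk') fun l _ hl => ?_).trans
        (Finset.sum_congr rfl fun l _ => by ring)
      rw [hP0 k l (not_lt.mp fun h => hl (Finset.mem_range.mpr h))]
      ring
  refine (MinorsMem.of_production hP h0 hME).mul hC.transpose fun i j => ?_
  filter_upwards [Filter.eventually_ge_atTop (i + 1)] with N hN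
  rw [hsum]
  refine Finset.sum_subset (Finset.range_mono hN) fun k _ hk => ?_
  rw [hM0 i k (by simpa using hk), zero_mul]

end Minors

/-! ### Recurrences for the triangle `B_{n,k}` -/

section LaguerreTriangle

variable (α : ℝ)

theorem laguerreTriangle_of_lt {n k : ℕ} (h : n < k) : laguerreTriangle α n k = 0 :=
  if_neg (Nat.not_le.mpr h)

theorem laguerreTriangle_add_left (m k : ℕ) :
    laguerreTriangle α (k + m) k =
      (∏ i ∈ Finset.range m, ((k : ℝ) + m + α - i)) / (m ! : ℝ) * (((k + m)! : ℝ) / (k ! : ℝ)) := by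
  rw [laguerreTriangle, if_pos (Nat.le_add_right k m), Nat.add_sub_cancel_left,
    ring_choose_real_eq]
  push_cast
  rfl

@[simp]
theorem laguerreTriangle_self (n : ℕ) : laguerreTriangle α n n = 1 := by
  have h := laguerreTriangle_add_left α 0 n
  have : (n ! : ℝ) ≠ 0 := by positivity
  simpa [this] using h

theorem sub_mul_laguerreTriangle (n k : ℕ) :
    ((n : ℝ) - k) * laguerreTriangle α n k =
      (k + 1) * (k + (α + 1)) * laguerreTriangle α n (k + 1) := by
  rcases lt_trichotomy n k with h | rfl | h
  · rw [laguerreTriangle_of_lt α h, laguerreTriangle_of_lt α (h.trans k.lt_succ_self)]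
    ring
  · rw [laguerreTriangle_of_lt α n.lt_succ_self]
    ring
  · obtain ⟨m, rfl⟩ := Nat.exists_eq_add_of_lt h
    have h1 := laguerreTriangle_add_left α (m + 1) k
    have h2 := laguerreTriangle_add_left α m (k + 1)
    rw [show k + 1 + m = k + m + 1 by ring] at h2
    rw [← add_assoc] at h1
    rw [h1, h2, Finset.prod_range_succ, Nat.factorial_succ m, Nat.factorial_succ k]
    have h3 : ∏ i ∈ Finset.range m, ((k : ℝ) + (m + 1 : ℕ) + α - i) =
        ∏ i ∈ Finset.range m, (((k + 1 : ℕ) : ℝ) + m + α - i) :=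
      Finset.prod_congr rfl fun i _ => by push_cast; ring
    rw [h3]
    have : (m ! : ℝ) ≠ 0 := by positivity
    have : (k ! : ℝ) ≠ 0 := by positivity
    have : (m : ℝ) + 1 ≠ 0 := by positivity
    have : (k : ℝ) + 1 ≠ 0 := by positivity
    push_cast
    field_simp
    ring

theorem succ_sub_mul_laguerreTriangle_succ {n k : ℕ} (h : k ≤ n) :
    ((n : ℝ) + 1 - k) * laguerreTriangle α (n + 1) k =
      (n + 1) * (n + (α + 1)) * laguerreTriangle α n k := by
  obtain ⟨m, rfl⟩ := Nat.exists_eq_add_of_le h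
  have h1 := laguerreTriangle_add_left α (m + 1) k
  have h2 := laguerreTriangle_add_left α m k
  rw [← add_assoc] at h1
  rw [h1, h2, Finset.prod_range_succ', Nat.factorial_succ m, Nat.factorial_succ (k + m)]
  have h3 : ∏ i ∈ Finset.range m, ((k : ℝ) + (m + 1 : ℕ) + α - (i + 1 : ℕ)) =
      ∏ i ∈ Finset.range m, ((k : ℝ) + m + α - i) :=
    Finset.prod_congr rfl fun i _ => by push_cast; ring
  rw [h3]
  have : (m ! : ℝ) ≠ 0 := by positivity
  have : (k ! : ℝ) ≠ 0 := by positivity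
  have : (m : ℝ) + 1 ≠ 0 := by positivity
  push_cast
  field_simp
  ring

theorem laguerreTriangle_succ_zero (n : ℕ) :
    laguerreTriangle α (n + 1) 0 = (n + (α + 1)) * laguerreTriangle α n 0 := by
  have h := succ_sub_mul_laguerreTriangle_succ α (Nat.zero_le n)
  have hn : (n : ℝ) + 1 ≠ 0 := by positivity
  refine mul_left_cancel₀ hn ?_
  simpa [mul_assoc] using h

theorem laguerreTriangle_succ_succ (n k : ℕ) :
    laguerreTriangle α (n + 1) (k + 1) = laguerreTriangle α n k +
      (n + (k + 1) + (α + 1)) * laguerreTriangle α n (k + 1) := by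
  rcases lt_trichotomy n k with h | rfl | h
  · simp [laguerreTriangle_of_lt α h, laguerreTriangle_of_lt α (h.trans k.lt_succ_self),
      laguerreTriangle_of_lt α (Nat.succ_lt_succ h)]
  · simp [laguerreTriangle_of_lt α n.lt_succ_self]
  -- Below the diagonal, the vertical and horizontal ratio relations combine after multiplication by
  -- `n - k ≠ 0`.
  · have h1 := succ_sub_mul_laguerreTriangle_succ α (Nat.succ_le_of_lt h)
    have h2 := sub_mul_laguerreTriangle α n k
    have hnk : (n : ℝ) - k ≠ 0 := sub_ne_zero.mpr (by exact_mod_cast h.ne')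
    refine mul_left_cancel₀ hnk ?_
    push_cast at h1
    rw [mul_add, h2]
    linear_combination h1

theorem laguerreTriangle_succ_zero' (n : ℕ) :
    laguerreTriangle α (n + 1) 0 = (α + 1) * laguerreTriangle α n 0 +
      (α + 1) * laguerreTriangle α n 1 := by
  have h := sub_mul_laguerreTriangle α n 0
  rw [laguerreTriangle_succ_zero]
  push_cast at h
  rw [zero_add] at h
  linear_combination h

/-- Trading the dependence on `n` for an entry of the next column leaves coefficients that depend on
the column only, as a production matrix requires. -/
theorem laguerreTriangle_succ_succ' (n k : ℕ) :
    laguerreTriangle α (n + 1) (k + 1) = laguerreTriangle α n k +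
      (2 * (k + 1) + (α + 1)) * laguerreTriangle α n (k + 1) +
      (k + 2) * (k + 1 + (α + 1)) * laguerreTriangle α n (k + 2) := by
  have h := sub_mul_laguerreTriangle α n (k + 1)
  rw [laguerreTriangle_succ_succ]
  push_cast at h
  linear_combination h

end LaguerreTriangle

/-! ### The production operator and its staircase factorization -/

section Production

variable {R : Type*} [CommRing R] {S : Subsemiring R}

/-- The matrix of a linear operator on polynomials, whose rows list the images of the monomials. -/
noncomputable def operatorMatrix (F : R[X] →ₗ[R] R[X]) (i j : ℕ) : R := (F (X ^ i)).coeff j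

theorem coeff_operator_apply (F : R[X] →ₗ[R] R[X]) (p : R[X]) {N : ℕ} (hN : p.natDegree < N)
    (j : ℕ) : (F p).coeff j = ∑ k ∈ Finset.range N, p.coeff k * operatorMatrix F k j := by
  conv_lhs => rw [p.as_sum_range' N hN]
  simp only [map_sum, finsetSum_coeff, operatorMatrix]
  refine Finset.sum_congr rfl fun k _ => ?_
  rw [← smul_X_eq_monomial, map_smul, coeff_smul, smul_eq_mul]

theorem MinorsMem.operatorMatrix_comp {F G : R[X] →ₗ[R] R[X]} (hF : MinorsMem S (operatorMatrix F))
    (hG : MinorsMem S (operatorMatrix G)) : MinorsMem S (operatorMatrix (G ∘ₗ F)) := by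
  refine hF.mul hG fun i j => ?_
  filter_upwards [Filter.eventually_gt_atTop (F (X ^ i)).natDegree] with N hN
  exact coeff_operator_apply G (F (X ^ i)) hN j

/-- The operator `1 + y ∂`. -/
noncomputable def oneAddDeriv (y : R) : R[X] →ₗ[R] R[X] := LinearMap.id + y • derivative

/-- The operator `(z + x) (1 + y ∂) + d`. -/
noncomputable def shiftedLaguerreFactor (x y d : R) : R[X] →ₗ[R] R[X] :=
  LinearMap.mulLeft R (X + C x) ∘ₗ oneAddDeriv y + d • LinearMap.id

theorem oneAddDeriv_apply (y : R) (p : R[X]) : oneAddDeriv y p = p + C y * derivative p := by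
  simp [oneAddDeriv, smul_eq_C_mul]

theorem shiftedLaguerreFactor_apply (x y d : R) (p : R[X]) : shiftedLaguerreFactor x y d p =
    (X + C x) * (p + C y * derivative p) + C d * p := by
  simp [shiftedLaguerreFactor, oneAddDeriv_apply, smul_eq_C_mul]

theorem operatorMatrix_oneAddDeriv (y : R) (i j : ℕ) : operatorMatrix (oneAddDeriv y) i j =
    if i = j then 1 else if i = j + 1 then i * y else 0 := by
  rw [operatorMatrix, oneAddDeriv_apply, derivative_X_pow, coeff_add, coeff_C_mul, coeff_C_mul,
    coeff_X_pow, coeff_X_pow]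
  rcases i with _ | i
  · simp [eq_comm]
  · by_cases h : i + 1 = j
    · rw [if_pos h, if_pos h.symm, Nat.add_sub_cancel, if_neg (show ¬ j = i by omega)]
      simp
    · by_cases h' : i = j
      · simp [h', mul_comm]
      · simp [h, h', Ne.symm h, Ne.symm h']

theorem minorsMem_oneAddDeriv {y : R} (hy : y ∈ S) :
    MinorsMem S (operatorMatrix (oneAddDeriv y)) := by
  refine MinorsMem.of_staircase (fun i j => ?_) fun i i' j j' hi h h' => ?_
  · rw [operatorMatrix_oneAddDeriv]
    split_ifs
    exacts [one_mem S, mul_mem (natCast_mem S i) hy, zero_mem S]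
  · rw [operatorMatrix_oneAddDeriv] at h h'
    split_ifs at h h' <;> first | omega | exact absurd rfl h | exact absurd rfl h'

theorem minorsMem_shiftedLaguerreFactor {x y d : R} (hx : x ∈ S) (hy : y ∈ S) (hd : d ∈ S) :
    MinorsMem S (operatorMatrix (shiftedLaguerreFactor x y d)) := by
  -- Row `2i` of `W` lists `z^i` and row `2i+1` lists `(z + x) z^i`. Row `i` of `V` writes the image
  -- `(z + x)(z^i + i y z^{i-1}) + d z^i` in these terms. At `i = 0` the truncated index `2i - 1` is
  -- harmless, its coefficient being zero.
  let V : ℕ → ℕ → R := fun i k => (if k = 2 * i + 1 then 1 else 0) + (if k = 2 * i then d else 0) +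
    (if k = 2 * i - 1 then i * y else 0)
  let W : ℕ → ℕ → R := fun k j => if k = 2 * j then 1 else if k = 2 * j + 1 then x else
    if k + 1 = 2 * j then 1 else 0
  have hV : MinorsMem S V := by
    have hV' : ∀ i k, V i k ≠ 0 → k ≤ 2 * i + 1 ∧ 2 * i ≤ k + 1 := by
      intro i k h
      by_contra hcon
      refine h ?_
      simp only [V]
      rw [if_neg (by omega), if_neg (by omega), if_neg (by omega)]
      simp
    refine MinorsMem.of_staircase (fun i k => ?_) fun i i' k k' hi h h' => ?_
    · refine add_mem (add_mem ?_ ?_) ?_ <;> split_ifs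
      exacts [one_mem S, zero_mem S, hd, zero_mem S, mul_mem (natCast_mem S i) hy, zero_mem S]
    · have := hV' _ _ h
      have := hV' _ _ h'
      omega
  have hW : MinorsMem S W := by
    have hW' : ∀ k j, W k j ≠ 0 → k ≤ 2 * j + 1 ∧ 2 * j ≤ k + 1 := by
      intro k j h
      by_contra hcon
      refine h ?_
      simp only [W]
      rw [if_neg (by omega), if_neg (by omega), if_neg (by omega)]
    refine MinorsMem.of_staircase (fun k j => ?_) fun k k' j j' hk h h' => ?_
    · simp only [W]
      split_ifs
      exacts [one_mem S, hx, one_mem S, zero_mem S]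
    · have := hW' _ _ h
      have := hW' _ _ h'
      omega
  refine hV.mul hW fun i j => ?_
  filter_upwards [Filter.eventually_ge_atTop (2 * i + 2)] with N hN
  have h1 : ∑ k ∈ Finset.range N, V i k * W k j =
      W (2 * i + 1) j + d * W (2 * i) j + i * y * W (2 * i - 1) j := by
    simp only [V, add_mul, Finset.sum_add_distrib, ite_mul, zero_mul, one_mul,
      Finset.sum_ite_eq', Finset.mem_range]
    rw [if_pos (by omega), if_pos (by omega), if_pos (by omega)]
  have hW0 : ∀ i, W (2 * i) j = (X ^ i : R[X]).coeff j := by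
    intro i
    simp only [W, coeff_X_pow]
    by_cases h : j = i
    · rw [if_pos (by omega), if_pos h]
    · rw [if_neg (by omega), if_neg (by omega), if_neg (by omega), if_neg h]
  have hW1 : ∀ i, W (2 * i + 1) j = ((X + C x) * X ^ i : R[X]).coeff j := by
    intro i
    rw [add_mul, ← pow_succ', coeff_add, coeff_C_mul, coeff_X_pow, coeff_X_pow]
    simp only [W]
    by_cases h : j = i
    · rw [if_neg (by omega), if_pos (by omega), if_neg (by omega), if_pos h]
      ring
    · by_cases h' : j = i + 1
      · rw [if_neg (by omega), if_neg (by omega), if_pos (by omega), if_pos h', if_neg h]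
        ring
      · rw [if_neg (by omega), if_neg (by omega), if_neg (by omega), if_neg h, if_neg h']
        ring
  rw [h1, operatorMatrix, shiftedLaguerreFactor_apply, hW1, hW0, derivative_X_pow]
  rcases i with _ | i
  · rw [← coeff_C_mul]
    simp
  · rw [show 2 * (i + 1) - 1 = 2 * i + 1 by omega, hW1, Nat.add_sub_cancel, ← coeff_C_mul,
      ← coeff_C_mul, ← coeff_add, ← coeff_add]
    congr 1
    simp only [C_mul, map_natCast]
    ring

/-- The production operator of the signless Laguerre polynomials. -/
noncomputable def laguerreProduction (x y d : R) : R[X] →ₗ[R] R[X] :=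
  shiftedLaguerreFactor x y d ∘ₗ oneAddDeriv y

theorem minorsMem_laguerreProduction {x y d : R} (hx : x ∈ S) (hy : y ∈ S) (hd : d ∈ S) :
    MinorsMem S (operatorMatrix (laguerreProduction x y d)) :=
  (minorsMem_oneAddDeriv hy).operatorMatrix_comp (minorsMem_shiftedLaguerreFactor hx hy hd)

/-- Translation commutes with `∂` and turns multiplication by `z` into multiplication by `z + x`. -/
theorem laguerreProduction_comp (x y d : R) (p : R[X]) :
    laguerreProduction x y d (p.comp (X + C x)) =
      (laguerreProduction 0 y d p).comp (X + C x) := by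
  simp only [laguerreProduction, LinearMap.comp_apply, oneAddDeriv_apply,
    shiftedLaguerreFactor_apply]
  simp [derivative_comp]

theorem natDegree_laguerreProduction_le (x y d : R) (p : R[X]) :
    (laguerreProduction x y d p).natDegree ≤ p.natDegree + 1 := by
  have h1 : ∀ p : R[X], (p + C y * derivative p).natDegree ≤ p.natDegree := fun p =>
    (natDegree_add_le _ _).trans (max_le le_rfl ((natDegree_C_mul_le _ _).trans
      ((natDegree_derivative_le p).trans (Nat.sub_le _ _))))
  simp only [laguerreProduction, LinearMap.comp_apply, oneAddDeriv_apply,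
    shiftedLaguerreFactor_apply]
  refine (natDegree_add_le _ _).trans (max_le ?_ ?_)
  · refine natDegree_mul_le.trans ?_
    have : (X + C x : R[X]).natDegree ≤ 1 := natDegree_add_C.trans_le natDegree_X_le
    have := (h1 (p + C y * derivative p)).trans (h1 p)
    omega
  · exact (natDegree_C_mul_le _ _).trans ((h1 p).trans (Nat.le_succ _))

/-- Iterating the production operator gives an output matrix and its zeroth column. -/
theorem minorsMem_laguerreProduction_iterate {x y d : R} (hx : x ∈ S) (hy : y ∈ S) (hd : d ∈ S)
    {p : ℕ → R[X]} (h0 : p 0 = 1) (hp : ∀ n, p (n + 1) = laguerreProduction x y d (p n)) :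
    MinorsMem S (fun n k => (p n).coeff k) ∧ MinorsMem S fun i j => (p (i + j)).coeff 0 := by
  have hdeg : ∀ n, (p n).natDegree ≤ n := by
    intro n
    induction n with
    | zero => simp [h0]
    | succ n ih =>
      rw [hp]
      exact (natDegree_laguerreProduction_le x y d _).trans (Nat.succ_le_succ ih)
  have hc0 : ∀ k, (p 0).coeff k = if k = 0 then 1 else 0 := fun k => by rw [h0, coeff_one]
  have hP := minorsMem_laguerreProduction hx hy hd
  constructor
  · refine MinorsMem.of_production hP hc0 fun i j => ?_
    filter_upwards [Filter.eventually_gt_atTop i] with N hN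
    rw [hp]
    exact coeff_operator_apply _ _ ((hdeg i).trans_lt hN) j
  · refine MinorsMem.hankel_of_production (M := fun n k => (p n).coeff k) hP (fun k l hkl => ?_) hc0
      (fun i k hik => coeff_eq_zero_of_natDegree_lt ((hdeg i).trans_lt hik)) fun i j => ?_
    · refine coeff_eq_zero_of_natDegree_lt (lt_of_le_of_lt ?_ hkl)
      exact (natDegree_laguerreProduction_le x y d _).trans
        (Nat.succ_le_succ (natDegree_X_pow_le k))
    · rw [hp]
      exact coeff_operator_apply _ _ (Nat.lt_succ_of_le (hdeg i)) j

variable [Algebra ℝ R]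

/-- The homogenized row-generating polynomial `∑_k B_{n,k} y^{n-k} z^k`. -/
noncomputable def homogeneousLaguerre (α : ℝ) (y : R) (n : ℕ) : R[X] :=
  ∑ k ∈ Finset.range (n + 1), C (algebraMap ℝ R (laguerreTriangle α n k) * y ^ (n - k)) * X ^ k

theorem coeff_homogeneousLaguerre (α : ℝ) (y : R) (n k : ℕ) :
    (homogeneousLaguerre α y n).coeff k =
      algebraMap ℝ R (laguerreTriangle α n k) * y ^ (n - k) := by
  simp only [homogeneousLaguerre, finsetSum_coeff, coeff_C_mul, coeff_X_pow, mul_ite, mul_one,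
    mul_zero, Finset.sum_ite_eq, Finset.mem_range]
  split_ifs with h
  · rfl
  · rw [laguerreTriangle_of_lt α (by omega), map_zero, zero_mul]

theorem homogeneousLaguerre_succ (α : ℝ) (y : R) (n : ℕ) :
    homogeneousLaguerre α y (n + 1) =
      laguerreProduction 0 y (algebraMap ℝ R (α + 1) * y) (homogeneousLaguerre α y n) := by
  -- For `k ≥ n` the exponents are truncated, but then `B_{n,k+1} = 0`.
  have hy1 : ∀ k, algebraMap ℝ R (laguerreTriangle α n (k + 1)) * y ^ (n - k) =
      algebraMap ℝ R (laguerreTriangle α n (k + 1)) * y ^ (n - (k + 1)) * y := by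
    intro k
    by_cases h : k < n
    · rw [show n - k = n - (k + 1) + 1 by omega]
      ring
    · rw [laguerreTriangle_of_lt α (by omega)]
      simp
  have hy0 : algebraMap ℝ R (laguerreTriangle α n 0) * y ^ (n + 1) =
      algebraMap ℝ R (laguerreTriangle α n 0) * y ^ n * y := by ring
  set a : ℕ → R := fun k => algebraMap ℝ R (laguerreTriangle α n k) * y ^ (n - k) with ha
  have hcoeff : ∀ k, (homogeneousLaguerre α y n).coeff k = a k :=
    coeff_homogeneousLaguerre α y n
  ext k
  simp only [laguerreProduction, LinearMap.comp_apply, oneAddDeriv_apply,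
    shiftedLaguerreFactor_apply, C_0, add_zero]
  rw [coeff_homogeneousLaguerre]
  rcases k with _ | k
  · simp only [coeff_add, coeff_C_mul, coeff_derivative, hcoeff, coeff_X_mul_zero]
    rw [laguerreTriangle_succ_zero']
    have h1 := hy1 0
    simp only [Nat.sub_zero, zero_add] at h1 ⊢
    simp only [ha, map_add, map_mul, Nat.sub_zero]
    push_cast
    linear_combination (algebraMap ℝ R α + 1) * y * h1
  · simp only [coeff_add, coeff_C_mul, coeff_derivative, hcoeff, coeff_X_mul]
    rw [laguerreTriangle_succ_succ', Nat.add_sub_add_right]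
    have h1 := hy1 k
    have h2 := hy1 (k + 1)
    have h3 : algebraMap ℝ R (laguerreTriangle α n (k + 1 + 1)) * y ^ (n - k) =
        algebraMap ℝ R (laguerreTriangle α n (k + 1 + 1)) * y ^ (n - (k + 1)) * y := by
      by_cases h : k < n
      · rw [show n - k = n - (k + 1) + 1 by omega]
        ring
      · rw [laguerreTriangle_of_lt α (by omega)]
        simp
    simp only [ha, map_add, map_mul, map_natCast, map_ofNat, map_one]
    push_cast
    generalize algebraMap ℝ R (laguerreTriangle α n (k + 1)) = b1 at *
    generalize algebraMap ℝ R (laguerreTriangle α n (k + 1 + 1)) = b2 at *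
    linear_combination (2 * ((k : R) + 1) + (algebraMap ℝ R α + 1)) * h1 +
      ((k : R) + 2) * (k + 1 + (algebraMap ℝ R α + 1)) * (h3 + y * h2)

theorem coeff_zero_homogeneousLaguerre_comp (α : ℝ) (x y : R) (n : ℕ) :
    ((homogeneousLaguerre α y n).comp (X + C x)).coeff 0 =
      ∑ k ∈ Finset.range (n + 1),
        algebraMap ℝ R (laguerreTriangle α n k) * x ^ k * y ^ (n - k) := by
  rw [coeff_zero_eq_eval_zero, eval_comp]
  simp only [eval_add, eval_X, eval_C, zero_add, homogeneousLaguerre, eval_finsetSum, eval_mul,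
    eval_pow]
  exact Finset.sum_congr rfl fun k _ => by ring

/-- Translating by `x` makes the value of the row polynomial at `x` the zeroth column of an output
matrix, so one production operator controls both the triangle and the Hankel matrices. -/
theorem minorsMem_homogeneousLaguerre {α : ℝ} {x y : R} (hx : x ∈ S) (hy : y ∈ S)
    (hα : algebraMap ℝ R (α + 1) ∈ S) :
    MinorsMem S (fun n k => ((homogeneousLaguerre α y n).comp (X + C x)).coeff k) ∧
      MinorsMem S fun i j => ∑ k ∈ Finset.range (i + j + 1),
        algebraMap ℝ R (laguerreTriangle α (i + j) k) * x ^ k * y ^ (i + j - k) := by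
  have h := minorsMem_laguerreProduction_iterate (d := algebraMap ℝ R (α + 1) * y) hx hy
    (mul_mem hα hy) (p := fun n => (homogeneousLaguerre α y n).comp (X + C x))
    (by simp [homogeneousLaguerre]) fun n => by
      rw [homogeneousLaguerre_succ, laguerreProduction_comp]
  simpa only [coeff_zero_homogeneousLaguerre_comp] using h

end Production

/-! ### From Hankel minors to 3-`q`-log-convexity -/

section QLogConvexity

variable {R : Type*} [CommRing R] {S : Subsemiring R}

/-- Polynomials with nonnegative coefficients. -/
def nonnegCoeffs : Subsemiring ℝ[X] where
  carrier := {p | HasNonnegCoeffs p}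
  mul_mem' {p q} hp hq i := by
    rw [coeff_mul]
    exact Finset.sum_nonneg fun _ _ => mul_nonneg (hp _) (hq _)
  one_mem' i := by
    rw [coeff_one]
    split_ifs <;> norm_num
  add_mem' {p q} hp hq i := by
    rw [coeff_add]
    exact add_nonneg (hp i) (hq i)
  zero_mem' i := by simp

theorem MinorsMem.det_hankel_mem {a : ℕ → R} (h : MinorsMem S fun i j => a (i + j)) (k n : ℕ) :
    (Matrix.of fun i j : Fin k => a (n + i + j)).det ∈ S :=
  h k (fun i => n + i) (fun j => j) (fun _ _ hij => Nat.add_lt_add_left hij n) fun _ _ hij => hij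

/-- A `q`-Stieltjes moment sequence is `3`-`q`-log-convex. -/
theorem IsQStieltjesMoment.isIteratedQLogConvex {a : ℕ → ℝ[X]} (h : IsQStieltjesMoment a) :
    IsIteratedQLogConvex 3 a := by
  have hS : MinorsMem nonnegCoeffs fun i j => a (i + j) := h
  have h1 : ∀ n, a n ∈ nonnegCoeffs := fun n => by simpa using hS.det_hankel_mem 1 n
  have e1 : ∀ n, logConvexOp a n = (Matrix.of fun i j : Fin 2 => a (n + i + j)).det := fun n => by
    simp [logConvexOp, Matrix.det_fin_two, sq]
  have h2 : ∀ n, logConvexOp a n ∈ nonnegCoeffs := fun n => e1 n ▸ hS.det_hankel_mem 2 n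
  -- Desnanot–Jacobi for the 3 × 3 Hankel matrix, whose central entry is `a (n + 2)`.
  have e2 : ∀ n, logConvexOp (logConvexOp a) n =
      a (n + 2) * (Matrix.of fun i j : Fin 3 => a (n + i + j)).det := fun n => by
    simp only [logConvexOp, Matrix.det_fin_three, Matrix.of_apply, add_assoc]
    norm_num
    ring
  have h3 : ∀ n, (Matrix.of fun i j : Fin 3 => a (n + i + j)).det ∈ nonnegCoeffs :=
    hS.det_hankel_mem 3
  -- With `D_n` the 3 × 3 minors, split off `D_n D_{n+2} (a_{n+2} a_{n+4} - a_{n+3}²)`; the rest is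
  -- `a_{n+3}² (D_n D_{n+2} - D_{n+1}²)`, to which Desnanot–Jacobi of order 4 applies.
  have e3 : ∀ n, logConvexOp (logConvexOp (logConvexOp a)) n =
      logConvexOp a (n + 2) * (Matrix.of fun i j : Fin 3 => a (n + i + j)).det *
        (Matrix.of fun i j : Fin 3 => a (n + 2 + i + j)).det +
      a (n + 3) * a (n + 3) * ((Matrix.of fun i j : Fin 4 => a (n + i + j)).det *
        logConvexOp a (n + 2)) := fun n => by
    rw [logConvexOp, e2, e2, e2]
    simp only [logConvexOp, Matrix.det_succ_row_zero (n := 3), Matrix.det_fin_three,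
      Fin.sum_univ_succ, Matrix.submatrix_apply, Matrix.of_apply, add_assoc, Fin.succAbove]
    norm_num [Fin.lt_def, Fin.sum_univ_succ]
    ring
  intro m hm n
  interval_cases m
  · exact h1 n
  · exact h2 n
  · change logConvexOp (logConvexOp a) n ∈ nonnegCoeffs
    rw [e2]
    exact mul_mem (h1 _) (h3 n)
  · change logConvexOp (logConvexOp (logConvexOp a)) n ∈ nonnegCoeffs
    rw [e3]
    exact add_mem (mul_mem (mul_mem (h2 _) (h3 _)) (h3 _))
      (mul_mem (mul_mem (h1 _) (h1 _)) (mul_mem (hS.det_hankel_mem 4 n) (h2 _)))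

end QLogConvexity

/-! ### Specializations: Laguerre polynomials, reciprocals, the triangle -/

section LaguerrePolynomials

variable {α : ℝ}

theorem C_mem_nonnegCoeffs {r : ℝ} (hr : 0 ≤ r) : C r ∈ nonnegCoeffs := fun i => by
  rw [coeff_C]
  split_ifs
  exacts [hr, le_rfl]

theorem X_mem_nonnegCoeffs : (X : ℝ[X]) ∈ nonnegCoeffs := fun i => by
  rw [coeff_X]
  split_ifs <;> norm_num

theorem signlessLaguerreReciprocal_eq_sum (α : ℝ) (n : ℕ) :
    signlessLaguerreReciprocal α n =
      ∑ k ∈ Finset.range (n + 1), C (laguerreTriangle α n k) * X ^ (n - k) := by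
  rw [signlessLaguerreReciprocal, signlessLaguerrePoly_eq_sum]
  have : ∀ s : Finset ℕ, (∀ k ∈ s, k ≤ n) →
      (∑ k ∈ s, C (laguerreTriangle α n k) * X ^ k).reflect n =
        ∑ k ∈ s, C (laguerreTriangle α n k) * X ^ (n - k) := by
    intro s
    induction s using Finset.induction_on with
    | empty => simp
    | insert k s hk ih =>
      intro h
      rw [Finset.sum_insert hk, Finset.sum_insert hk, reflect_add, reflect_C_mul_X_pow,
        ih fun j hj => h j (Finset.mem_insert_of_mem hj),
        revAt_le (h k (Finset.mem_insert_self k s))]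
  exact this _ fun k hk => Nat.lt_succ_iff.mp (Finset.mem_range.mp hk)

theorem isQStieltjesMoment_signlessLaguerrePoly (hα : -1 ≤ α) :
    IsQStieltjesMoment (signlessLaguerrePoly α) := by
  have h := (minorsMem_homogeneousLaguerre (α := α) X_mem_nonnegCoeffs (one_mem nonnegCoeffs)
    (C_mem_nonnegCoeffs (by linarith))).2
  simp only [one_pow, mul_one] at h
  simp only [IsQStieltjesMoment, signlessLaguerrePoly_eq_sum]
  exact h

theorem isQStieltjesMoment_signlessLaguerreReciprocal (hα : -1 ≤ α) :
    IsQStieltjesMoment (signlessLaguerreReciprocal α) := by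
  have h := (minorsMem_homogeneousLaguerre (α := α) (one_mem nonnegCoeffs) X_mem_nonnegCoeffs
    (C_mem_nonnegCoeffs (by linarith))).2
  simp only [one_pow, mul_one] at h
  simp only [IsQStieltjesMoment, signlessLaguerreReciprocal_eq_sum]
  exact h

theorem isTotallyPositive_laguerreTriangle (hα : -1 ≤ α) :
    IsTotallyPositive (laguerreTriangle α) := by
  have h := (minorsMem_homogeneousLaguerre (R := ℝ) (S := Subsemiring.nonneg ℝ) (α := α)
    (zero_mem _) (one_mem _) (by simpa using by linarith)).1
  have he : (fun n k => ((homogeneousLaguerre α (1 : ℝ) n).comp (X + C 0)).coeff k) =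
      laguerreTriangle α := by
    ext n k
    simp [coeff_homogeneousLaguerre]
  rw [he] at h
  exact h

theorem laguerreTriangle_nonneg (hα : -1 ≤ α) (n k : ℕ) : 0 ≤ laguerreTriangle α n k := by
  simpa using isTotallyPositive_laguerreTriangle hα 1 (fun _ => n) (fun _ => k)
    (Subsingleton.strictMono _) (Subsingleton.strictMono _)

end LaguerrePolynomials

/-! ### Poisson mixtures of gamma distributions -/

section MomentKernel

variable {α : ℝ}

theorem cast_descFactorial_succ (N k : ℕ) :
    ((N.descFactorial (k + 1) : ℕ) : ℝ) = (N - k) * N.descFactorial k := by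
  rcases le_or_gt k N with h | h
  · rw [Nat.descFactorial_succ, Nat.cast_mul, Nat.cast_sub h]
  · simp [Nat.descFactorial_eq_zero_iff_lt.mpr h]

/-- A Chu–Vandermonde expansion: splitting the new factor as `(N - k) + (n + k + α + 1)` reproduces
the recurrence `laguerreTriangle_succ_succ`. -/
theorem prod_add_eq_sum_laguerreTriangle_mul_descFactorial (α : ℝ) (N n : ℕ) :
    ∏ i ∈ Finset.range n, (α + 1 + N + i) =
      ∑ k ∈ Finset.range (n + 1), laguerreTriangle α n k * N.descFactorial k := by
  induction n with
  | zero => simp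
  | succ n ih =>
    rw [Finset.prod_range_succ, ih, Finset.sum_range_succ' _ (n + 1), laguerreTriangle_succ_zero]
    have h1 : ∑ k ∈ Finset.range (n + 1),
          (n + (k + 1 : ℕ) + (α + 1)) * laguerreTriangle α n (k + 1) * N.descFactorial (k + 1) +
        (n + ((0 : ℕ) : ℝ) + (α + 1)) * laguerreTriangle α n 0 * N.descFactorial 0 =
        ∑ k ∈ Finset.range (n + 1),
          (n + k + (α + 1)) * laguerreTriangle α n k * N.descFactorial k := by
      rw [← Finset.sum_range_succ' (fun k : ℕ =>
          (n + (k : ℝ) + (α + 1)) * laguerreTriangle α n k * N.descFactorial k) (n + 1),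
        Finset.sum_range_succ, laguerreTriangle_of_lt α n.lt_succ_self]
      ring
    have h2 : ∀ k, laguerreTriangle α (n + 1) (k + 1) * N.descFactorial (k + 1) =
        laguerreTriangle α n k * ((N - k) * N.descFactorial k) +
        (n + (k + 1 : ℕ) + (α + 1)) * laguerreTriangle α n (k + 1) * N.descFactorial (k + 1) := by
      intro k
      rw [laguerreTriangle_succ_succ, ← cast_descFactorial_succ]
      push_cast
      ring
    simp only [h2, Finset.sum_add_distrib]
    have h3 : (n + (α + 1)) * laguerreTriangle α n 0 * (N.descFactorial 0 : ℝ) =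
        (n + ((0 : ℕ) : ℝ) + (α + 1)) * laguerreTriangle α n 0 * N.descFactorial 0 := by
      simp
    rw [h3, add_assoc (∑ k ∈ _, _), h1, ← Finset.sum_add_distrib, Finset.sum_mul]
    exact Finset.sum_congr rfl fun k _ => by ring

/-- The factorial moments of the Poisson distribution. -/
theorem hasSum_poisson_mul_descFactorial {q : ℝ} (hq : 0 ≤ q) (k : ℕ) :
    HasSum (fun N : ℕ => Real.exp (-q) * q ^ N / (N ! : ℝ) * N.descFactorial k) (q ^ k) := by
  -- The first `k` terms vanish; the shifted series is `q^k` times the total Poisson mass.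
  rw [← hasSum_nat_add_iff' k, Finset.sum_eq_zero, sub_zero]
  · have h := (ProbabilityTheory.hasSum_one_poissonMeasure q.toNNReal).mul_left (q ^ k)
    rw [mul_one, Real.coe_toNNReal q hq] at h
    refine h.congr_fun fun N => ?_
    have h1 : ((N + k)! : ℝ) = (N ! : ℝ) * (N + k).descFactorial k := by
      have := Nat.factorial_mul_descFactorial (Nat.le_add_left k N)
      rw [Nat.add_sub_cancel] at this
      exact_mod_cast this.symm
    have h2 : ((N + k)! : ℝ) ≠ 0 := by positivity
    have h3 : (N ! : ℝ) ≠ 0 := by positivity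
    rw [h1] at h2 ⊢
    have h4 := right_ne_zero_of_mul h2
    field_simp
    ring
  · intro N hN
    simp [Nat.descFactorial_eq_zero_iff_lt.mpr (Finset.mem_range.mp hN)]

/-- The moments of the scaled Poisson mixture of gamma distributions. -/
theorem hasSum_poisson_mul_rising (α : ℝ) {s t : ℝ} (hs : 0 ≤ s) (ht : 0 < t) (n : ℕ) :
    HasSum (fun N : ℕ => Real.exp (-(s / t)) * (s / t) ^ N / (N ! : ℝ) *
      (t ^ n * ∏ i ∈ Finset.range n, (α + 1 + N + i)))
      (∑ k ∈ Finset.range (n + 1), laguerreTriangle α n k * s ^ k * t ^ (n - k)) := by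
  have h := hasSum_sum fun k (_ : k ∈ Finset.range (n + 1)) =>
    (hasSum_poisson_mul_descFactorial (div_nonneg hs ht.le) k).mul_left
      (t ^ n * laguerreTriangle α n k)
  have he : ∑ k ∈ Finset.range (n + 1), t ^ n * laguerreTriangle α n k * (s / t) ^ k =
      ∑ k ∈ Finset.range (n + 1), laguerreTriangle α n k * s ^ k * t ^ (n - k) := by
    refine Finset.sum_congr rfl fun k hk => ?_
    have hk' : k ≤ n := Nat.lt_succ_iff.mp (Finset.mem_range.mp hk)
    rw [div_pow, show t ^ n = t ^ (n - k) * t ^ k by rw [← pow_add, Nat.sub_add_cancel hk']]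
    have : t ^ k ≠ 0 := (pow_pos ht k).ne'
    field_simp
  rw [he] at h
  refine h.congr_fun fun N => ?_
  rw [prod_add_eq_sum_laguerreTriangle_mul_descFactorial, Finset.mul_sum, Finset.mul_sum]
  exact Finset.sum_congr rfl fun k _ => by ring

theorem Real.Gamma_add_nat_eq_prod {a : ℝ} (ha : 0 < a) (n : ℕ) :
    Real.Gamma (a + n) = (∏ i ∈ Finset.range n, (a + i)) * Real.Gamma a := by
  induction n with
  | zero => simp
  | succ n ih =>
    rw [Nat.cast_succ, ← add_assoc, Real.Gamma_add_one (by positivity), ih,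
      Finset.prod_range_succ]
    ring

/-- The rising factorials of `a ≥ 0` are the moments of a gamma distribution. -/
theorem exists_measure_moment_rising {a : ℝ} (ha : 0 ≤ a) :
    ∃ γ : Measure ℝ, IsProbabilityMeasure γ ∧ (∀ᵐ u ∂γ, 0 ≤ u) ∧
      ∀ n : ℕ, ∫⁻ u, ENNReal.ofReal (u ^ n) ∂γ =
        ENNReal.ofReal (∏ i ∈ Finset.range n, (a + i)) := by
  rcases ha.eq_or_lt with rfl | ha
  -- The gamma law of shape `0` degenerates to a point mass; this occurs for `α = -1`, `N = 0`.
  · refine ⟨Measure.dirac 0, inferInstance, by simp [ae_dirac_eq], fun n => ?_⟩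
    rw [lintegral_dirac]
    cases n with
    | zero => simp
    | succ n => simp [Finset.prod_range_succ']
  · refine ⟨ProbabilityTheory.gammaMeasure a 1,
      ProbabilityTheory.isProbabilityMeasure_gammaMeasure ha one_pos, ?_, fun n => ?_⟩
    · have h : ProbabilityTheory.gammaMeasure a 1 (Set.Iio 0) = 0 := by
        rw [ProbabilityTheory.gammaMeasure, withDensity_apply _ measurableSet_Iio]
        exact ProbabilityTheory.lintegral_gammaPDF_of_nonpos le_rfl
      simpa [ae_iff, Set.Iio] using h
    · have hm : ∀ b : ℝ, Measurable (ProbabilityTheory.gammaPDF b 1) := fun b =>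
        (ProbabilityTheory.measurable_gammaPDFReal b 1).ennreal_ofReal
      have han : 0 < a + n := by positivity
      rw [ProbabilityTheory.gammaMeasure, lintegral_withDensity_eq_lintegral_mul _ (hm a)
        (by fun_prop)]
      -- Multiplying the density by `u^n` raises the shape from `a` to `a + n`, up to a ratio of
      -- gamma values. The point `u = 0` is excluded because adding exponents of real powers needs a
      -- nonzero base.
      have hae : (ProbabilityTheory.gammaPDF a 1 * fun u : ℝ => ENNReal.ofReal (u ^ n)) =ᵐ[volume]
          fun u => ENNReal.ofReal (∏ i ∈ Finset.range n, (a + i)) *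
            ProbabilityTheory.gammaPDF (a + n) 1 u := by
        filter_upwards [Measure.ae_ne volume (0 : ℝ)] with u hu
        rw [Pi.mul_apply]
        rcases hu.lt_or_gt with hu | hu
        · rw [ProbabilityTheory.gammaPDF_of_neg hu, ProbabilityTheory.gammaPDF_of_neg hu]
          simp
        · have hP : 0 ≤ ∏ i ∈ Finset.range n, (a + i) :=
            Finset.prod_nonneg fun i _ => by positivity
          rw [ProbabilityTheory.gammaPDF_of_nonneg hu.le,
            ProbabilityTheory.gammaPDF_of_nonneg hu.le, ← ENNReal.ofReal_mul' (by positivity),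
            ← ENNReal.ofReal_mul hP, Real.Gamma_add_nat_eq_prod ha]
          congr 1
          have h1 : 0 < ∏ i ∈ Finset.range n, (a + i) :=
            Finset.prod_pos fun i _ => by positivity
          have h2 := Real.Gamma_pos_of_pos ha
          rw [show a + n - 1 = a - 1 + n by ring, Real.rpow_add_natCast hu.ne']
          simp only [Real.one_rpow]
          field_simp
      rw [lintegral_congr_ae hae, lintegral_const_mul _ (hm _),
        ProbabilityTheory.lintegral_gammaPDF_eq_one han one_pos, mul_one]

end MomentKernel

/-! ### Preservation of Stieltjes moment sequences -/

section StieltjesMoments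

variable {α : ℝ}

theorem isStieltjesMoment_of_lintegral {a : ℕ → ℝ} {μ : Measure ℝ} (hμ : ∀ᵐ x ∂μ, 0 ≤ x)
    (ha : ∀ n, 0 ≤ a n)
    (h : ∀ n : ℕ, ∫⁻ x, ENNReal.ofReal (x ^ n) ∂μ = ENNReal.ofReal (a n)) :
    IsStieltjesMoment a := by
  refine ⟨μ, by simpa [ae_iff, Set.Iio] using hμ, fun n => ?_⟩
  have hn : 0 ≤ᵐ[μ] fun x : ℝ => x ^ n := by
    filter_upwards [hμ] with x hx
    exact pow_nonneg hx n
  have hm : AEStronglyMeasurable (fun x : ℝ => x ^ n) μ := by fun_prop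
  refine ⟨⟨hm, ?_⟩, ?_⟩
  · rw [hasFiniteIntegral_iff_ofReal hn, h]
    exact ENNReal.ofReal_lt_top
  · rw [integral_eq_lintegral_of_nonneg_ae hn hm, h, ENNReal.toReal_ofReal (ha n)]

/-- The mixture is built as a countable sum over the Poisson value `N`, each weight `w N` serving as
a density on pairs `(s, t)`, so no measurable kernel is needed. Pairs with `t = 0` are treated
apart, where `s / t` is meaningless. -/
theorem exists_measure_lintegral_eq_laguerre {γ : ℕ → Measure ℝ}
    [∀ N, IsProbabilityMeasure (γ N)] (hα : -1 ≤ α) (hγ0 : ∀ N, ∀ᵐ u ∂γ N, 0 ≤ u)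
    (hγ : ∀ N n : ℕ, ∫⁻ u, ENNReal.ofReal (u ^ n) ∂γ N =
      ENNReal.ofReal (∏ i ∈ Finset.range n, (α + 1 + N + i)))
    (ρ : Measure (ℝ × ℝ)) [SFinite ρ] (hρ : ∀ᵐ p ∂ρ, 0 ≤ p.1 ∧ 0 ≤ p.2) :
    ∃ κ : Measure ℝ, (∀ᵐ x ∂κ, 0 ≤ x) ∧ ∀ n : ℕ, ∫⁻ x, ENNReal.ofReal (x ^ n) ∂κ =
      ∫⁻ p, ENNReal.ofReal (∑ k ∈ Finset.range (n + 1),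
        laguerreTriangle α n k * p.1 ^ k * p.2 ^ (n - k)) ∂ρ := by
  let A : Set (ℝ × ℝ) := {p | p.2 = 0}
  have hA : MeasurableSet A := measurable_snd (measurableSet_singleton 0)
  let w : ℕ → ℝ × ℝ → ENNReal := fun N p =>
    ENNReal.ofReal (Real.exp (-(p.1 / p.2)) * (p.1 / p.2) ^ N / (N ! : ℝ))
  have hw : ∀ N, Measurable (w N) := fun N => by fun_prop
  let g : (ℝ × ℝ) × ℝ → ℝ := fun z => z.1.2 * z.2
  have hg : Measurable g := by fun_prop
  let κ₁ : ℕ → Measure ℝ := fun N => (((ρ.restrict Aᶜ).withDensity (w N)).prod (γ N)).map g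
  let κ₀ : Measure ℝ := (ρ.restrict A).map Prod.fst
  have hpos1 : ∀ N, ∀ᵐ x ∂κ₁ N, 0 ≤ x := by
    intro N
    refine (ae_map_iff hg.aemeasurable measurableSet_Ici).mpr ?_
    have h1 : ∀ᵐ p ∂(ρ.restrict Aᶜ).withDensity (w N), 0 ≤ p.1 ∧ 0 ≤ p.2 :=
      (withDensity_absolutelyContinuous _ _).ae_le (ae_restrict_of_ae hρ)
    filter_upwards [Measure.quasiMeasurePreserving_fst.ae h1,
      Measure.quasiMeasurePreserving_snd.ae (hγ0 N)] with z hz hz'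
    exact mul_nonneg hz.2 hz'
  have hpos0 : ∀ᵐ x ∂κ₀, 0 ≤ x := by
    refine (ae_map_iff measurable_fst.aemeasurable measurableSet_Ici).mpr ?_
    filter_upwards [ae_restrict_of_ae hρ] with p hp
    exact hp.1
  refine ⟨Measure.sum κ₁ + κ₀, ae_add_measure_iff.mpr ⟨Measure.ae_sum_iff.mpr hpos1, hpos0⟩,
    fun n => ?_⟩
  have hf : Measurable fun x : ℝ => ENNReal.ofReal (x ^ n) := by fun_prop
  have h1 : ∀ N, ∫⁻ x, ENNReal.ofReal (x ^ n) ∂κ₁ N = ∫⁻ p in Aᶜ, w N p *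
      ENNReal.ofReal (p.2 ^ n * ∏ i ∈ Finset.range n, (α + 1 + N + i)) ∂ρ := by
    intro N
    rw [lintegral_map hf hg,
      lintegral_prod (fun z => ENNReal.ofReal (g z ^ n)) (hf.comp hg).aemeasurable,
      lintegral_withDensity_eq_lintegral_mul _ (hw N)
        (Measurable.lintegral_prod_right' (f := fun z => ENNReal.ofReal (g z ^ n)) (hf.comp hg))]
    refine lintegral_congr_ae ?_
    filter_upwards [ae_restrict_of_ae hρ] with p hp
    have hp2 : 0 ≤ p.2 ^ n := pow_nonneg hp.2 n
    simp only [Pi.mul_apply, g, mul_pow, ENNReal.ofReal_mul hp2]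
    rw [lintegral_const_mul _ hf, hγ]
  have h0 : ∫⁻ x, ENNReal.ofReal (x ^ n) ∂κ₀ = ∫⁻ p in A, ENNReal.ofReal (∑ k ∈
      Finset.range (n + 1), laguerreTriangle α n k * p.1 ^ k * p.2 ^ (n - k)) ∂ρ := by
    rw [lintegral_map hf measurable_fst]
    refine setLIntegral_congr_fun hA fun p hp => ?_
    have hp : p.2 = 0 := hp
    simp only [hp]
    -- At `t = 0` only the term `k = n` survives, and `B_{n,n} = 1`.
    rw [Finset.sum_range_succ, Finset.sum_eq_zero]
    · simp
    · intro k hk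
      rw [zero_pow (by have := Finset.mem_range.mp hk; omega), mul_zero]
  rw [lintegral_add_measure, lintegral_sum_measure, h0, add_comm,
    ← lintegral_add_compl (μ := ρ) _ hA]
  congr 1
  rw [tsum_congr h1, ← lintegral_tsum fun N => by fun_prop]
  refine lintegral_congr_ae ?_
  filter_upwards [ae_restrict_of_ae hρ, ae_restrict_mem hA.compl] with p hp hpA
  have hp2 : 0 < p.2 := lt_of_le_of_ne hp.2 (Ne.symm hpA)
  have hsum := hasSum_poisson_mul_rising α hp.1 hp2 n
  have hq : 0 ≤ p.1 / p.2 := div_nonneg hp.1 hp.2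
  have hn1 : ∀ N : ℕ, 0 ≤ Real.exp (-(p.1 / p.2)) * (p.1 / p.2) ^ N / (N ! : ℝ) :=
    fun N => by positivity
  have hn2 : ∀ N : ℕ, 0 ≤ p.2 ^ n * ∏ i ∈ Finset.range n, (α + 1 + N + i) := fun N =>
    mul_nonneg (pow_nonneg hp.2 n) (Finset.prod_nonneg fun i _ => by
      have : 0 ≤ α + 1 := by linarith
      positivity)
  rw [← hsum.tsum_eq, ENNReal.ofReal_tsum_of_nonneg (fun N => mul_nonneg (hn1 N) (hn2 N))
    hsum.summable]
  exact tsum_congr fun N => (ENNReal.ofReal_mul (hn1 N)).symm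

theorem preservesStieltjesMoment_laguerreTriangle (hα : -1 ≤ α) :
    PreservesStieltjesMoment (laguerreTriangle α) := by
  rintro x y ⟨μ, hμ0, hμ⟩ ⟨ν, hν0, hν⟩
  -- Integrability of the zeroth power makes the measures finite, as the product measure needs.
  have hfin : ∀ {ξ : Measure ℝ} {z : ℕ → ℝ},
      (∀ k : ℕ, Integrable (fun x : ℝ => x ^ k) ξ ∧ z k = ∫ x, x ^ k ∂ξ) → IsFiniteMeasure ξ := by
    intro ξ z h
    have := (h 0).1
    simp only [pow_zero] at this
    exact (integrable_const_iff_isFiniteMeasure one_ne_zero).mp this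
  have := hfin hμ
  have := hfin hν
  have hμ' : ∀ᵐ s ∂μ, 0 ≤ s := by simpa [ae_iff, Set.Iio] using hμ0
  have hν' : ∀ᵐ t ∂ν, 0 ≤ t := by simpa [ae_iff, Set.Iio] using hν0
  have hα' : ∀ N : ℕ, 0 ≤ α + 1 + N := fun N => by
    have : 0 ≤ α + 1 := by linarith
    positivity
  choose γ hγp hγ0 hγ using fun N : ℕ => exists_measure_moment_rising (hα' N)
  have hρ : ∀ᵐ p ∂μ.prod ν, 0 ≤ p.1 ∧ 0 ≤ p.2 := by
    filter_upwards [Measure.quasiMeasurePreserving_fst.ae hμ',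
      Measure.quasiMeasurePreserving_snd.ae hν'] with p h1 h2
    exact ⟨h1, h2⟩
  obtain ⟨κ, hκ0, hκ⟩ := exists_measure_lintegral_eq_laguerre hα hγ0 hγ (μ.prod ν) hρ
  have hint : ∀ n k : ℕ, Integrable
      (fun p : ℝ × ℝ => laguerreTriangle α n k * p.1 ^ k * p.2 ^ (n - k)) (μ.prod ν) := by
    intro n k
    simp only [mul_assoc]
    exact ((hμ k).1.mul_prod (hν (n - k)).1).const_mul _
  have hz : ∀ n, triangularConvolution (laguerreTriangle α) x y n =
      ∫ p, ∑ k ∈ Finset.range (n + 1),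
        laguerreTriangle α n k * p.1 ^ k * p.2 ^ (n - k) ∂μ.prod ν := by
    intro n
    rw [integral_finsetSum _ fun k _ => hint n k]
    refine Finset.sum_congr rfl fun k _ => ?_
    simp only [mul_assoc]
    rw [integral_const_mul, integral_prod_mul (fun s : ℝ => s ^ k) (fun t : ℝ => t ^ (n - k)),
      ← (hμ k).2, ← (hν (n - k)).2]
  have hnn : ∀ n : ℕ, 0 ≤ᵐ[μ.prod ν] fun p : ℝ × ℝ => ∑ k ∈ Finset.range (n + 1),
      laguerreTriangle α n k * p.1 ^ k * p.2 ^ (n - k) := by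
    intro n
    filter_upwards [hρ] with p hp
    exact Finset.sum_nonneg fun k _ => mul_nonneg (mul_nonneg (laguerreTriangle_nonneg hα n k)
      (pow_nonneg hp.1 k)) (pow_nonneg hp.2 _)
  refine isStieltjesMoment_of_lintegral hκ0 (fun n => ?_) fun n => ?_
  · rw [hz]
    exact integral_nonneg_of_ae (hnn n)
  · rw [hκ, hz, ofReal_integral_eq_lintegral_ofReal
      (integrable_finsetSum _ fun k _ => hint n k) (hnn n)]

end StieltjesMoments

theorem mainTheorem9 (α : ℝ) (hα : -1 ≤ α) :
    (IsQStieltjesMoment (signlessLaguerrePoly α) ∧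
      IsIteratedQLogConvex 3 (signlessLaguerrePoly α) ∧
      IsQStieltjesMoment (signlessLaguerreReciprocal α) ∧
      IsIteratedQLogConvex 3 (signlessLaguerreReciprocal α)) ∧
    IsTotallyPositive (laguerreTriangle α) ∧
    PreservesStieltjesMoment (laguerreTriangle α) := by
  have h1 := isQStieltjesMoment_signlessLaguerrePoly hα
  have h2 := isQStieltjesMoment_signlessLaguerreReciprocal hα
  exact ⟨⟨h1, h1.isIteratedQLogConvex, h2, h2.isIteratedQLogConvex⟩,
    isTotallyPositive_laguerreTriangle hα, preservesStieltjesMoment_laguerreTriangle hα⟩
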